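/- Let $H$ be a separable complex Hilbert space (of finite or countably infinite dimension), let $B(H)$ be the algebra of bounded linear operators on $H$, and let $B_{sk}(H)=\{a\in B(H): a^*=-a\}$, regarded as a real Lie algebra with bracket $[a,b]=ab-ba$. A linear map $D:B_{sk}(H)\to B_{sk}(H)$ is an \emph{inner derivation} if there is $a\in B_{sk}(H)$ with $D(x)=[a,x]$ for all $x\in B_{sk}(H)$. An $\mathbb{R}$-linear map $\nabla:B_{sk}(H)\to B_{sk}(H)$ is a \emph{local inner derivation} if for every $x\in B_{sk}(H)$ there is an inner derivation $D$, possibly depending on $x$, with $\nabla(x)=D(x)$. The \emph{ultraweak topology} on $B_{sk}(H)$ is the restriction of the coarsest topology on $B(H)$ making all functionals $a\mapsto\sum_{n}\langle a\xi_n,\eta_n\rangle$ continuous, where $(\xi_n)$, $(\eta_n)$ are sequences in $H$ with $\sum_n\|\xi_n\|^2<\infty$ and $\sum_n\|\eta_n\|^2<\infty$. Then every local inner derivation $\nabla$ on $B_{sk}(H)$ that is continuous from the ultraweak topology to the ultraweak topology is an inner derivation: there is $a\in B_{sk}(H)$ such that $\nabla(x)=[a,x]$ for all $x\in B_{sk}(H)$.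 -/

import Mathlib

open scoped Topology

attribute [local instance] LieRing.ofAssociativeRing

section InnerDerivations

variable {R L : Type*} [CommRing R] [LieRing L] [LieAlgebra R L]

/-- A linear map `D` on a Lie algebra `L` is an inner derivation if `D x = ⁅a, x⁆` for some
fixed `a` in `L` and all `x`. -/
def IsInnerDerivation (D : L →ₗ[R] L) : Prop :=
  ∃ a : L, ∀ x : L, D x = ⁅a, x⁆

/-- A linear map `D` on a Lie algebra `L` is a local inner derivation if at every point `x` it
agrees with some inner derivation of `L`, which may depend on `x`. -/
def IsLocalInnerDerivation (D : L →ₗ[R] L) : Prop :=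
  ∀ x : L, ∃ E : L →ₗ[R] L, IsInnerDerivation E ∧ D x = E x

end InnerDerivations

noncomputable section SkewAdjointOperators

variable (H : Type*) [NormedAddCommGroup H] [InnerProductSpace ℂ H] [CompleteSpace H]

/-- The real Lie algebra of bounded operators `a` on `H` with `a* = -a`, with bracket
`⁅a, b⁆ = a * b - b * a`. -/
def skewAdjointOperators : LieSubalgebra ℝ (H →L[ℂ] H) where
  carrier := {a | star a = -a}
  add_mem' {a b} ha hb := by
    simp only [Set.mem_ofPred_eq] at ha hb ⊢
    rw [star_add, ha, hb, neg_add]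
  zero_mem' := by simp
  smul_mem' c a ha := by
    simp only [Set.mem_ofPred_eq] at ha ⊢
    rw [star_smul, ha, star_trivial, smul_neg]
  lie_mem' {a b} ha hb := by
    simp only [Set.mem_ofPred_eq, LieRing.of_associative_ring_bracket] at ha hb ⊢
    change star a = -a at ha
    change star b = -b at hb
    change star (a * b - b * a) = -(a * b - b * a)
    rw [star_sub, star_mul, star_mul, ha, hb]
    noncomm_ring

variable {H}

/-- The functional `a ↦ ∑ₙ ⟪y n, a (x n)⟫` on bounded operators. -/
def vectorSeriesFunctional (x y : ℕ → H) (a : H →L[ℂ] H) : ℂ :=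
  ∑' n, inner ℂ (y n) (a (x n))

/-- The series defining `vectorSeriesFunctional` converges absolutely for square-summable
sequences of vectors. -/
theorem summable_vectorSeries {H : Type*} [NormedAddCommGroup H] [InnerProductSpace ℂ H]
    {x y : ℕ → H} (hx : Summable fun n => ‖x n‖ ^ 2)
    (hy : Summable fun n => ‖y n‖ ^ 2) (a : H →L[ℂ] H) :
    Summable fun n => ‖inner ℂ (y n) (a (x n))‖ := by
  refine Summable.of_nonneg_of_le (fun n => norm_nonneg _) (fun n => ?_)
    ((hx.add hy).mul_left ‖a‖)
  have h1 : ‖inner ℂ (y n) (a (x n))‖ ≤ ‖y n‖ * (‖a‖ * ‖x n‖) :=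
    (norm_inner_le_norm _ _).trans
      (mul_le_mul_of_nonneg_left (a.le_opNorm _) (norm_nonneg _))
  have h2 : ‖y n‖ * ‖x n‖ ≤ ‖x n‖ ^ 2 + ‖y n‖ ^ 2 := by
    nlinarith [sq_nonneg (‖x n‖ - ‖y n‖), sq_nonneg ‖x n‖, sq_nonneg ‖y n‖]
  calc ‖inner ℂ (y n) (a (x n))‖ ≤ ‖a‖ * (‖y n‖ * ‖x n‖) := by linarith
    _ ≤ ‖a‖ * (‖x n‖ ^ 2 + ‖y n‖ ^ 2) := mul_le_mul_of_nonneg_left h2 (norm_nonneg _)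

variable (H)

/-- The ultraweak (σ-weak) topology on the bounded operators on `H`: the coarsest topology making
all functionals `a ↦ ∑ₙ ⟪y n, a (x n)⟫` continuous, where `∑ₙ ‖x n‖² < ∞` and
`∑ₙ ‖y n‖² < ∞`. -/
abbrev ultraweakTopology : TopologicalSpace (H →L[ℂ] H) :=
  ⨅ (x : ℕ → H) (y : ℕ → H) (_ : Summable fun n => ‖x n‖ ^ 2) (_ : Summable fun n => ‖y n‖ ^ 2),
    TopologicalSpace.induced (vectorSeriesFunctional x y) inferInstance

/-- The ultraweak topology on the skew-adjoint operators, as a subspace of all bounded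
operators. -/
abbrev skewUltraweakTopology : TopologicalSpace (skewAdjointOperators H) :=
  TopologicalSpace.induced Subtype.val (ultraweakTopology H)

end SkewAdjointOperators

/-!
If `T` is skew-adjoint and `T u = μ i u`, `T v = μ i v`, then `⟪u, ⁅b, T⁆ v⟫ = 0` for every `b`, so
a local inner derivation `D` satisfies `⟪u, D T v⟫ = 0`. All information on `D` is drawn from this
one orthogonality relation.

Write `x ∧ e = x ⊗ e* - e ⊗ x*`. Fix a unit vector `e` and subtract an inner derivation so that `D`
kills `i e ⊗ e*`. Applied to `x ∧ e + s i e ⊗ e*`, for suitable real `s`, and to `i z ⊗ z*` with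
`z = e - i x`, the relation shows that `D (x ∧ e) = (g x) ∧ e`, where `g x = D (x ∧ e) e` is complex
linear and skew-symmetric. An everywhere defined skew-symmetric map is bounded (Hellinger–Toeplitz),
so `g` is a skew-adjoint operator `a`, and `D` agrees with `ad a` on all `x ∧ e`. Subtract `ad a`.
For any `T` and any `v` not orthogonal to `e` some `x ∧ e` agrees with `T` at `v`, so `v` is in the
kernel of `T - x ∧ e` and `⟪v, D T v⟫ = 0`. Varying `v` gives `D T = 0`.
-/

namespace IsLocalInnerDerivation

section LieAlgebra

variable {R L : Type*} [CommRing R] [LieRing L] [LieAlgebra R L] {D : L →ₗ[R] L}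

theorem exists_apply_eq_lie (hD : IsLocalInnerDerivation D) (x : L) : ∃ a : L, D x = ⁅a, x⁆ := by
  obtain ⟨E, ⟨a, ha⟩, hE⟩ := hD x
  exact ⟨a, hE.trans (ha x)⟩

theorem sub_ad (hD : IsLocalInnerDerivation D) (b : L) :
    IsLocalInnerDerivation (D - LieAlgebra.ad R L b) := fun x => by
  obtain ⟨a, ha⟩ := hD.exists_apply_eq_lie x
  exact ⟨LieAlgebra.ad R L (a - b), ⟨a - b, fun _ => rfl⟩, by simp [ha]⟩

end LieAlgebra

end IsLocalInnerDerivation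

section

open Complex ComplexConjugate ContinuousLinearMap InnerProductSpace

theorem smul_eq_re_smul_add_im_smul_I_smul {E : Type*} [AddCommGroup E] [Module ℂ E] (c : ℂ)
    (x : E) : c • x = c.re • x + c.im • I • x := by
  conv_lhs => rw [← re_add_im c, add_smul, mul_smul, Complex.coe_smul, Complex.coe_smul]

variable {H : Type*} [NormedAddCommGroup H] [InnerProductSpace ℂ H] [CompleteSpace H]

namespace skewAdjointOperators

theorem inner_apply_right (T : skewAdjointOperators H) (u v : H) :
    inner ℂ u (T.1 v) = -inner ℂ (T.1 u) v := by
  have hT : adjoint T.1 = -T.1 := T.2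
  rw [← adjoint_inner_left, hT, _root_.neg_apply, inner_neg_left]

theorem add_apply (S T : skewAdjointOperators H) (v : H) : (S + T).1 v = S.1 v + T.1 v := rfl

theorem sub_apply (S T : skewAdjointOperators H) (v : H) : (S - T).1 v = S.1 v - T.1 v := rfl

theorem neg_apply (T : skewAdjointOperators H) (v : H) : (-T).1 v = -T.1 v := rfl

theorem smul_apply (c : ℝ) (T : skewAdjointOperators H) (v : H) :
    (c • T).1 v = (c : ℂ) • T.1 v := rfl

theorem lie_apply (a T : skewAdjointOperators H) (v : H) :
    (⁅a, T⁆ : skewAdjointOperators H).1 v = a.1 (T.1 v) - T.1 (a.1 v) := rfl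

theorem eq_zero_of_inner_apply_self {T : skewAdjointOperators H}
    (hT : ∀ v, inner ℂ v (T.1 v) = 0) : T = 0 := by
  have h : (T.1 : H →ₗ[ℂ] H) = 0 :=
    (inner_map_self_eq_zero _).1 fun v => inner_eq_zero_symm.1 (hT v)
  exact Subtype.ext (ContinuousLinearMap.ext fun v => LinearMap.congr_fun h v)

theorem eq_zero_of_apply_apply {T : skewAdjointOperators H}
    (hT : ∀ v, T.1 (T.1 v) = 0) : T = 0 := by
  refine Subtype.ext (ContinuousLinearMap.ext fun v => ?_)
  have h := inner_apply_right T v (T.1 v)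
  rw [hT, inner_zero_right, zero_eq_neg, inner_self_eq_zero] at h
  exact h

theorem exists_coe_eq_of_inner_add_inner_eq_zero {g : H →ₗ[ℂ] H}
    (hg : ∀ x, inner ℂ (g x) x + inner ℂ x (g x) = 0) :
    ∃ a : skewAdjointOperators H, ∀ x, a.1 x = g x := by
  have hsymm : (I • g).IsSymmetric := by
    refine (LinearMap.isSymmetric_iff_inner_map_self_real _).2 fun x => ?_
    simp only [LinearMap.smul_apply, inner_smul_left, map_mul, inner_conj_symm, conj_I, map_neg]
    linear_combination I * hg x
  refine ⟨⟨-I • hsymm.toSelfAdjoint.1, ?_⟩, fun x => ?_⟩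
  · change star (-I • hsymm.toSelfAdjoint.1) = -(-I • hsymm.toSelfAdjoint.1)
    rw [star_smul, hsymm.toSelfAdjoint.2.star_eq]
    simp
  · have hx : hsymm.toSelfAdjoint.1 x = I • g x := hsymm.toSelfAdjoint_apply
    change -I • hsymm.toSelfAdjoint.1 x = g x
    rw [hx, smul_smul, neg_mul, I_mul_I, neg_neg, one_smul]

/-- The skew-adjoint operator `x ⊗ y* - y ⊗ x*`, where `x ⊗ y*` is the rank-one operator
`v ↦ ⟪y, v⟫ x`, as a real-bilinear function of `x` and `y`. In particular
`wedge (I • x) x = 2 * I * (x ⊗ x*)`. -/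
noncomputable def wedge : H →ₗ[ℝ] H →ₗ[ℝ] skewAdjointOperators H :=
  LinearMap.mk₂ ℝ
    (fun x y => ⟨rankOne ℂ x y - rankOne ℂ y x, by
      change star (_ - _) = -(_ - _)
      rw [star_sub, star_eq_adjoint, star_eq_adjoint, adjoint_rankOne, adjoint_rankOne, neg_sub]⟩)
    (fun x x' y => Subtype.ext <| by
      ext v
      simp only [map_add, _root_.add_apply, _root_.sub_apply, rankOne_apply, AddMemClass.mk_add_mk]
      module)
    (fun c x y => Subtype.ext <| by
      ext v
      simp only [← Complex.coe_smul, map_smul, _root_.smul_apply, ContinuousLinearMap.map_smulₛₗ,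
        conj_ofReal, _root_.sub_apply, rankOne_apply, SetLike.mk_smul_mk]
      module)
    (fun x y y' => Subtype.ext <| by
      ext v
      simp only [map_add, _root_.add_apply, _root_.sub_apply, rankOne_apply, AddMemClass.mk_add_mk]
      module)
    (fun c x y => Subtype.ext <| by
      ext v
      simp only [← Complex.coe_smul, map_smul, _root_.smul_apply, ContinuousLinearMap.map_smulₛₗ,
        conj_ofReal, _root_.sub_apply, rankOne_apply, SetLike.mk_smul_mk]
      module)

theorem wedge_apply (x y v : H) :
    (wedge x y).1 v = (inner ℂ y v : ℂ) • x - (inner ℂ x v : ℂ) • y := rfl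

theorem wedge_self (x : H) : wedge x x = 0 :=
  Subtype.ext <| ContinuousLinearMap.ext fun v => by rw [wedge_apply, sub_self]; rfl

theorem wedge_swap (x y : H) : wedge y x = -wedge x y :=
  Subtype.ext <| ContinuousLinearMap.ext fun v => by
    change (wedge y x).1 v = -(wedge x y).1 v
    rw [wedge_apply, wedge_apply, neg_sub]

theorem wedge_I_smul_I_smul (x y : H) : wedge (I • x) (I • y) = wedge x y :=
  Subtype.ext <| ContinuousLinearMap.ext fun v => by
    simp only [wedge_apply, inner_smul_left, conj_I, smul_smul, neg_mul, mul_right_comm I _ I,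
      I_mul_I, one_mul, neg_neg]

theorem wedge_I_smul_self_apply (z v : H) :
    (wedge (I • z) z).1 v = (2 * I * inner ℂ z v : ℂ) • z := by
  rw [wedge_apply, inner_smul_left, conj_I]
  module

theorem lie_wedge (a : skewAdjointOperators H) (x y : H) :
    ⁅a, wedge x y⁆ = wedge (a.1 x) y + wedge x (a.1 y) :=
  Subtype.ext <| ContinuousLinearMap.ext fun v => by
    change a.1 ((wedge x y).1 v) - (wedge x y).1 (a.1 v) =
      (wedge (a.1 x) y).1 v + (wedge x (a.1 y)).1 v
    simp only [wedge_apply, map_sub, map_smul, inner_apply_right]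
    module

theorem wedge_I_smul_sub_I_smul (e x : H) :
    wedge (I • (e - I • x)) (e - I • x) =
      wedge (I • e) e + wedge (I • x) x + (2 : ℝ) • wedge x e := by
  have h : I • (e - I • x) = I • e + x := by
    rw [smul_sub, smul_smul, I_mul_I, neg_one_smul, sub_neg_eq_add]
  simp only [h, map_add, map_sub, LinearMap.add_apply, wedge_I_smul_I_smul, wedge_swap x e,
    wedge_swap (I • x) x]
  module

theorem exists_wedge_apply_eq (T : skewAdjointOperators H) {e v : H} (hv : inner ℂ e v ≠ 0) :
    ∃ x, (wedge x e).1 v = T.1 v := by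
  have hv' : inner ℂ v e ≠ 0 := mt inner_eq_zero_symm.1 hv
  set s : ℂ := inner ℂ (T.1 v) v / (2 * inner ℂ v e) with hs
  have hs' : conj s * inner ℂ e v = -inner ℂ (T.1 v) v / 2 := by
    rw [hs, map_div₀, map_mul, inner_conj_symm, inner_conj_symm, inner_apply_right, conj_ofNat]
    field_simp
  refine ⟨(inner ℂ e v)⁻¹ • (T.1 v + s • e), ?_⟩
  have hx : inner ℂ ((inner ℂ e v)⁻¹ • (T.1 v + s • e)) v = s := by
    rw [inner_smul_left, inner_add_left, inner_smul_left, hs', map_inv₀, inner_conj_symm, hs]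
    field_simp
    ring
  rw [wedge_apply, hx, smul_inv_smul₀ hv, add_sub_cancel_right]

theorem map_wedge_smul_self {V : Type*} [AddCommGroup V] [Module ℝ V]
    {f : skewAdjointOperators H →ₗ[ℝ] V} {e : H} (hf : f (wedge (I • e) e) = 0) (c : ℂ) :
    f (wedge (c • e) e) = 0 := by
  rw [smul_eq_re_smul_add_im_smul_I_smul, map_add, map_smul, map_smul,
    LinearMap.add_apply, LinearMap.smul_apply, LinearMap.smul_apply, wedge_self, smul_zero,
    zero_add, map_smul, hf, smul_zero]

theorem exists_orthogonal_map_wedge_eq {V : Type*} [AddCommGroup V] [Module ℝ V]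
    {f : skewAdjointOperators H →ₗ[ℝ] V} {e : H} (he : ‖e‖ = 1)
    (hf : f (wedge (I • e) e) = 0) (x : H) :
    ∃ (y : H) (c : ℂ), inner ℂ e y = 0 ∧ x = y + c • e ∧ f (wedge x e) = f (wedge y e) := by
  refine ⟨x - (inner ℂ e x : ℂ) • e, inner ℂ e x, ?_, (sub_add_cancel _ _).symm, ?_⟩
  · rw [inner_sub_right, inner_smul_right, inner_self_eq_norm_sq_to_K, he]
    simp
  · rw [map_sub, LinearMap.sub_apply, map_sub, map_wedge_smul_self hf, sub_zero]

end skewAdjointOperators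

namespace IsLocalInnerDerivation

open skewAdjointOperators

variable {D : skewAdjointOperators H →ₗ[ℝ] skewAdjointOperators H}

theorem inner_apply_eq_zero_of_eigenvectors (hD : IsLocalInnerDerivation D)
    {T : skewAdjointOperators H} {μ : ℝ} {u v : H} (hu : T.1 u = (μ * I : ℂ) • u)
    (hv : T.1 v = (μ * I : ℂ) • v) : inner ℂ u ((D T).1 v) = 0 := by
  obtain ⟨b, hb⟩ := hD.exists_apply_eq_lie T
  rw [hb, lie_apply, inner_sub_right, inner_apply_right T, hu, hv, map_smul, inner_smul_right,
    inner_smul_left]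
  simp

theorem inner_apply_eq_zero_of_mem_ker (hD : IsLocalInnerDerivation D)
    {T : skewAdjointOperators H} {u v : H} (hu : T.1 u = 0) (hv : T.1 v = 0) :
    inner ℂ u ((D T).1 v) = 0 :=
  hD.inner_apply_eq_zero_of_eigenvectors (μ := 0) (by simpa using hu) (by simpa using hv)

theorem inner_apply_wedge_smul_add (hD : IsLocalInnerDerivation D) {e x : H} (he : ‖e‖ = 1)
    (hDe : D (wedge (I • e) e) = 0) (hx : inner ℂ e x = 0) {μ : ℝ} (hμ : μ ≠ 0) :
    inner ℂ ((μ * I : ℂ) • e + x) ((D (wedge x e)).1 ((μ * I : ℂ) • e + x)) = 0 := by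
  -- This multiple of `wedge (I • e) e` makes `(μ * I) • e + x` an eigenvector for `μ * I`.
  set T := wedge x e + ((μ - ‖x‖ ^ 2 / μ) / 2) • wedge (I • e) e
  have hDT : D T = D (wedge x e) := by rw [map_add, map_smul, hDe, smul_zero, add_zero]
  have hT : T.1 ((μ * I : ℂ) • e + x) = (μ * I : ℂ) • ((μ * I : ℂ) • e + x) := by
    change (wedge x e).1 _ + ((μ - ‖x‖ ^ 2 / μ) / 2) • (wedge (I • e) e).1 _ = _
    have hμ' : (μ : ℂ) ≠ 0 := ofReal_ne_zero.2 hμ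
    rw [wedge_I_smul_self_apply, wedge_apply, ← Complex.coe_smul]
    simp only [inner_add_right, inner_smul_right, inner_self_eq_norm_sq_to_K, he, hx,
      inner_eq_zero_symm.1 hx]
    match_scalars
    · simp
    · field_simp
      linear_combination (-μ * ‖x‖ ^ 2 : ℂ) * I_sq
  simpa only [hDT] using hD.inner_apply_eq_zero_of_eigenvectors hT hT

theorem inner_apply_wedge_of_inner_eq_zero (hD : IsLocalInnerDerivation D) {e x : H} (he : ‖e‖ = 1)
    (hDe : D (wedge (I • e) e) = 0) (hx : inner ℂ e x = 0) :
    inner ℂ e ((D (wedge x e)).1 e) = 0 ∧ inner ℂ x ((D (wedge x e)).1 x) = 0 ∧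
      inner ℂ x ((D (wedge x e)).1 e) = inner ℂ e ((D (wedge x e)).1 x) := by
  set q := D (wedge x e) with hq
  have key {μ : ℝ} (hμ : μ ≠ 0) : (μ ^ 2 : ℂ) * inner ℂ e (q.1 e) +
      μ * I * (inner ℂ x (q.1 e) - inner ℂ e (q.1 x)) + inner ℂ x (q.1 x) = 0 := by
    have h := hD.inner_apply_wedge_smul_add he hDe hx hμ
    simp only [← hq, map_add, map_smul, inner_add_left, inner_add_right, inner_smul_left,
      inner_smul_right, map_mul, conj_ofReal, conj_I] at h
    linear_combination h + (μ ^ 2 * inner ℂ e (q.1 e) : ℂ) * I_mul_I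
  have h₁ := key (μ := 1) (by norm_num)
  have h₂ := key (μ := -1) (by norm_num)
  have h₃ := key (μ := 2) (by norm_num)
  push_cast at h₁ h₂ h₃
  refine ⟨?_, ?_, ?_⟩
  · linear_combination h₃ / 3 - h₁ / 2 + h₂ / 6
  · linear_combination h₁ - h₃ / 3 + h₂ / 3
  · linear_combination (-I / 2) * (h₁ - h₂) + (inner ℂ x (q.1 e) - inner ℂ e (q.1 x)) * I_mul_I

theorem inner_apply_wedge_add_of_orthogonal (hD : IsLocalInnerDerivation D) {e x u : H}
    (he : ‖e‖ = 1) (hDe : D (wedge (I • e) e) = 0) (hx : inner ℂ e x = 0)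
    (heu : inner ℂ e u = 0) (hxu : inner ℂ x u = 0) :
    inner ℂ u ((D (wedge (I • x) x)).1 (I • x)) +
      2 * inner ℂ u ((D (wedge x e)).1 ((‖x‖ ^ 2 : ℂ) • e + I • x)) = 0 := by
  -- Both `u` and `‖x‖ ^ 2 • e + I • x` are orthogonal to `e - I • x`.
  have hz : D (wedge (I • (e - I • x)) (e - I • x)) =
      D (wedge (I • x) x) + (2 : ℝ) • D (wedge x e) := by
    rw [wedge_I_smul_sub_I_smul, map_add, map_add, map_smul D, hDe, zero_add]
  have hxe : inner ℂ x e = 0 := inner_eq_zero_symm.1 hx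
  have hzu : inner ℂ (e - I • x) u = 0 := by
    rw [inner_sub_left, inner_smul_left, heu, hxu, mul_zero, sub_zero]
  have hzw : inner ℂ (e - I • x) ((‖x‖ ^ 2 : ℂ) • e + I • x) = 0 := by
    simp only [inner_sub_left, inner_smul_left, inner_add_right, inner_smul_right,
      inner_self_eq_norm_sq_to_K, hx, hxe, he, conj_I]
    push_cast
    linear_combination (‖x‖ ^ 2 : ℂ) * I_mul_I
  have h := hD.inner_apply_eq_zero_of_mem_ker (u := u) (v := (‖x‖ ^ 2 : ℂ) • e + I • x)
    (T := wedge (I • (e - I • x)) (e - I • x))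
    (by rw [wedge_I_smul_self_apply, hzu, mul_zero, zero_smul])
    (by rw [wedge_I_smul_self_apply, hzw, mul_zero, zero_smul])
  have hPe : inner ℂ u ((D (wedge (I • x) x)).1 e) = 0 :=
    hD.inner_apply_eq_zero_of_mem_ker
      (by rw [wedge_I_smul_self_apply, hxu, mul_zero, zero_smul])
      (by rw [wedge_I_smul_self_apply, hxe, mul_zero, zero_smul])
  rw [hz, skewAdjointOperators.add_apply, skewAdjointOperators.smul_apply,
    map_add (D (wedge (I • x) x)).1, map_smul (D (wedge (I • x) x)).1,
    inner_add_right, inner_add_right, inner_smul_right, hPe, mul_zero, zero_add,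
    inner_smul_right, ofReal_ofNat] at h
  exact h

theorem inner_apply_wedge_right_of_orthogonal (hD : IsLocalInnerDerivation D) {e x u : H}
    (he : ‖e‖ = 1) (hDe : D (wedge (I • e) e) = 0) (hx : inner ℂ e x = 0)
    (heu : inner ℂ e u = 0) (hxu : inner ℂ x u = 0) : inner ℂ u ((D (wedge x e)).1 x) = 0 := by
  have h₁ := hD.inner_apply_wedge_add_of_orthogonal he hDe hx heu hxu
  have h₂ := hD.inner_apply_wedge_add_of_orthogonal he hDe (x := -x)
    (by rw [inner_neg_right, hx, neg_zero]) heu (by rw [inner_neg_left, hxu, neg_zero])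
  simp only [smul_neg, map_neg, LinearMap.neg_apply, skewAdjointOperators.neg_apply, neg_neg,
    norm_neg, map_add, map_smul, inner_add_right, inner_smul_right, inner_neg_right] at h₁ h₂
  linear_combination (-I / 4) * (h₁ + h₂) + inner ℂ u ((D (wedge x e)).1 x) * I_mul_I

theorem norm_sq_mul_inner_apply_wedge_of_orthogonal (hD : IsLocalInnerDerivation D) {e x u : H}
    (he : ‖e‖ = 1) (hDe : D (wedge (I • e) e) = 0) (hx : inner ℂ e x = 0)
    (heu : inner ℂ e u = 0) (hxu : inner ℂ x u = 0) :
    2 * (‖x‖ ^ 2 : ℂ) * inner ℂ u ((D (wedge x e)).1 e) =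
      -I * inner ℂ u ((D (wedge (I • x) x)).1 x) := by
  have h := hD.inner_apply_wedge_add_of_orthogonal he hDe hx heu hxu
  simp only [map_add, map_smul, inner_add_right, inner_smul_right,
    hD.inner_apply_wedge_right_of_orthogonal he hDe hx heu hxu] at h
  linear_combination h

theorem apply_wedge_eq_wedge (hD : IsLocalInnerDerivation D) {e x : H} (he : ‖e‖ = 1)
    (hDe : D (wedge (I • e) e) = 0) (hx : inner ℂ e x = 0) :
    D (wedge x e) = wedge ((D (wedge x e)).1 e) e := by
  obtain ⟨hee, hxx, -⟩ := hD.inner_apply_wedge_of_inner_eq_zero he hDe hx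
  set q := D (wedge x e)
  set R := q - wedge (q.1 e) e
  have hRv (v : H) : R.1 v = q.1 v - ((inner ℂ e v : ℂ) • q.1 e - (inner ℂ (q.1 e) v : ℂ) • e) :=
    rfl
  have hRe : R.1 e = 0 := by
    rw [hRv, inner_self_eq_norm_sq_to_K, he, inner_eq_zero_symm.1 hee]
    simp
  have he_R (v : H) : inner ℂ e (R.1 v) = 0 := by
    rw [inner_apply_right, hRe, inner_zero_left, neg_zero]
  have hRq {u v : H} (hu : inner ℂ e u = 0) (hv : inner ℂ e v = 0) :
      inner ℂ u (R.1 v) = inner ℂ u (q.1 v) := by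
    rw [hRv, hv, zero_smul, zero_sub, sub_neg_eq_add, inner_add_right, inner_smul_right,
      inner_eq_zero_symm.1 hu, mul_zero, add_zero]
  have hRx : R.1 x = 0 := by
    rw [← inner_self_eq_zero (𝕜 := ℂ), hRq (he_R x) hx]
    exact hD.inner_apply_wedge_right_of_orthogonal he hDe hx (he_R x) ((hRq hx hx).trans hxx)
  have hx_R (v : H) : inner ℂ x (R.1 v) = 0 := by
    rw [inner_apply_right, hRx, inner_zero_left, neg_zero]
  have hker {u : H} (heu : inner ℂ e u = 0) (hxu : inner ℂ x u = 0) : (wedge x e).1 u = 0 := by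
    rw [wedge_apply, heu, hxu, zero_smul, zero_smul, sub_zero]
  refine sub_eq_zero.1 (eq_zero_of_apply_apply (T := R) fun v => ?_)
  rw [← inner_self_eq_zero (𝕜 := ℂ), hRq (he_R _) (he_R _)]
  exact hD.inner_apply_eq_zero_of_mem_ker (hker (he_R _) (hx_R _)) (hker (he_R _) (hx_R _))

theorem inner_apply_wedge_add_inner_eq_zero (hD : IsLocalInnerDerivation D) {e x : H}
    (he : ‖e‖ = 1) (hDe : D (wedge (I • e) e) = 0) (hx : inner ℂ e x = 0) :
    inner ℂ ((D (wedge x e)).1 e) x + inner ℂ x ((D (wedge x e)).1 e) = 0 := by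
  rw [(hD.inner_apply_wedge_of_inner_eq_zero he hDe hx).2.2, inner_apply_right, add_neg_cancel]

theorem apply_wedge_I_smul_of_orthogonal (hD : IsLocalInnerDerivation D) {e x : H} (he : ‖e‖ = 1)
    (hDe : D (wedge (I • e) e) = 0) (hx : inner ℂ e x = 0) :
    (D (wedge (I • x) e)).1 e = I • (D (wedge x e)).1 e := by
  rcases eq_or_ne x 0 with rfl | hx0
  · simp
  have hIx : inner ℂ e (I • x) = 0 := by rw [inner_smul_right, hx, mul_zero]
  set d := (D (wedge (I • x) e)).1 e - I • (D (wedge x e)).1 e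
  have hed : inner ℂ e d = 0 := by
    rw [inner_sub_right, inner_smul_right, (hD.inner_apply_wedge_of_inner_eq_zero he hDe hx).1,
      (hD.inner_apply_wedge_of_inner_eq_zero he hDe hIx).1, mul_zero, sub_zero]
  have hxd : inner ℂ x d = 0 := by
    have h₁ := hD.inner_apply_wedge_add_inner_eq_zero he hDe hx
    have h₂ := hD.inner_apply_wedge_add_inner_eq_zero he hDe hIx
    have h₃ := hD.inner_apply_wedge_add_inner_eq_zero he hDe (x := x + I • x)
      (by rw [inner_add_right, hx, hIx, add_zero])
    have hadd : (D (wedge (x + I • x) e)).1 e =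
        (D (wedge x e)).1 e + (D (wedge (I • x) e)).1 e := by
      rw [map_add, LinearMap.add_apply, map_add, skewAdjointOperators.add_apply]
    rw [hadd] at h₃
    simp only [inner_add_left, inner_add_right, inner_smul_left, inner_smul_right, conj_I]
      at h₂ h₃
    rw [inner_sub_right, inner_smul_right]
    linear_combination (h₃ - (1 + I) * h₁ - (1 - I) * h₂) / 2 +
      (inner ℂ x ((D (wedge (I • x) e)).1 e) - inner ℂ ((D (wedge (I • x) e)).1 e) x) / 2 * I_sq
  have hdd : inner ℂ d d = 0 := by
    have hIxd : inner ℂ (I • x) d = 0 := by rw [inner_smul_left, hxd, mul_zero]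
    have h₁ := hD.norm_sq_mul_inner_apply_wedge_of_orthogonal he hDe hx hed hxd
    have h₂ := hD.norm_sq_mul_inner_apply_wedge_of_orthogonal he hDe hIx hed hIxd
    rw [wedge_I_smul_I_smul, norm_smul, norm_I, one_mul, map_smul (D (wedge (I • x) x)).1,
      inner_smul_right] at h₂
    have hx0' : 2 * (‖x‖ ^ 2 : ℂ) ≠ 0 := by simpa using hx0
    refine (mul_eq_zero.1 ?_).resolve_left hx0'
    conv_lhs => enter [2]; rw [inner_sub_right, inner_smul_right]
    linear_combination h₂ - I * h₁
  exact sub_eq_zero.1 (inner_self_eq_zero.1 hdd)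

theorem apply_wedge_smul (hD : IsLocalInnerDerivation D) {e : H} (he : ‖e‖ = 1)
    (hDe : D (wedge (I • e) e) = 0) (c : ℂ) (x : H) :
    (D (wedge (c • x) e)).1 e = c • (D (wedge x e)).1 e := by
  have hI : (D (wedge (I • x) e)).1 e = I • (D (wedge x e)).1 e := by
    obtain ⟨y, d, hy, rfl, hxy⟩ := exists_orthogonal_map_wedge_eq he hDe x
    rw [hxy, smul_add, smul_smul, map_add, LinearMap.add_apply, map_add,
      map_wedge_smul_self hDe, add_zero, hD.apply_wedge_I_smul_of_orthogonal he hDe hy]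
  rw [smul_eq_re_smul_add_im_smul_I_smul, map_add, map_smul, map_smul,
    LinearMap.add_apply, LinearMap.smul_apply, LinearMap.smul_apply, map_add, map_smul, map_smul,
    skewAdjointOperators.add_apply, skewAdjointOperators.smul_apply,
    skewAdjointOperators.smul_apply, hI, smul_smul, ← add_smul, re_add_im]

theorem exists_forall_apply_wedge_eq_lie (hD : IsLocalInnerDerivation D) {e : H} (he : ‖e‖ = 1)
    (hDe : D (wedge (I • e) e) = 0) :
    ∃ a : skewAdjointOperators H, ∀ x, D (wedge x e) = ⁅a, wedge x e⁆ := by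
  obtain ⟨g, hg⟩ : ∃ g : H →ₗ[ℂ] H, ∀ x, g x = (D (wedge x e)).1 e :=
    ⟨{ toFun x := (D (wedge x e)).1 e
       map_add' x y := by
         rw [map_add, LinearMap.add_apply, map_add, skewAdjointOperators.add_apply]
       map_smul' := hD.apply_wedge_smul he hDe }, fun _ => rfl⟩
  have hg_skew (x : H) : inner ℂ (g x) x + inner ℂ x (g x) = 0 := by
    obtain ⟨y, c, hy, rfl, hxy⟩ := exists_orthogonal_map_wedge_eq he hDe x
    have hge : inner ℂ e ((D (wedge y e)).1 e) = 0 :=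
      (hD.inner_apply_wedge_of_inner_eq_zero he hDe hy).1
    rw [hg, hxy, inner_add_left, inner_add_right, inner_smul_left, inner_smul_right, hge,
      inner_eq_zero_symm.1 hge, mul_zero, mul_zero, add_zero, add_zero,
      hD.inner_apply_wedge_add_inner_eq_zero he hDe hy]
  obtain ⟨a, ha⟩ := exists_coe_eq_of_inner_add_inner_eq_zero hg_skew
  have hae : a.1 e = 0 := by
    rw [ha, hg, wedge_self, map_zero]
    rfl
  refine ⟨a, fun x => ?_⟩
  obtain ⟨y, c, hy, -, hxy⟩ := exists_orthogonal_map_wedge_eq he hDe x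
  calc D (wedge x e) = wedge ((D (wedge x e)).1 e) e := by
        rw [hxy]
        exact hD.apply_wedge_eq_wedge he hDe hy
    _ = ⁅a, wedge x e⁆ := by
        rw [lie_wedge, hae, map_zero, add_zero, ha, hg]

theorem eq_zero_of_apply_wedge_eq_zero (hD : IsLocalInnerDerivation D) {e : H} (he : e ≠ 0)
    (hDe : ∀ x, D (wedge x e) = 0) : D = 0 := by
  refine LinearMap.ext fun T => eq_zero_of_inner_apply_self ?_
  have key {v : H} (hv : inner ℂ e v ≠ 0) : inner ℂ v ((D T).1 v) = 0 := by
    obtain ⟨x, hx⟩ := exists_wedge_apply_eq T hv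
    have hker : (T - wedge x e).1 v = 0 := by
      rw [skewAdjointOperators.sub_apply, hx, sub_self]
    simpa only [map_sub, hDe, sub_zero] using hD.inner_apply_eq_zero_of_mem_ker hker hker
  intro v
  by_cases hv : inner ℂ e v = 0
  · have hee : inner ℂ e e ≠ 0 := inner_self_ne_zero.2 he
    have h₁ := key (v := v + e) (by rwa [inner_add_right, hv, zero_add])
    have h₂ := key (v := v - e) (by rwa [inner_sub_right, hv, zero_sub, neg_ne_zero])
    simp only [map_add, map_sub, inner_add_left, inner_sub_left, inner_add_right,
      inner_sub_right, key hee] at h₁ h₂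
    linear_combination (h₁ + h₂) / 2
  · exact key hv

end IsLocalInnerDerivation

theorem mainTheorem3_general {D : skewAdjointOperators H →ₗ[ℝ] skewAdjointOperators H}
    (hD : IsLocalInnerDerivation D) : IsInnerDerivation D := by
  rcases subsingleton_or_nontrivial H with hH | hH
  · exact ⟨0, fun x => Subtype.ext (ContinuousLinearMap.ext fun v => Subsingleton.elim _ _)⟩
  obtain ⟨e, he⟩ := exists_norm_eq H zero_le_one
  obtain ⟨b, hb⟩ := hD.exists_apply_eq_lie (skewAdjointOperators.wedge (I • e) e)
  have hDb := hD.sub_ad b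
  obtain ⟨a, ha⟩ := hDb.exists_forall_apply_wedge_eq_lie he (sub_eq_zero.2 hb)
  have hDab := (hDb.sub_ad a).eq_zero_of_apply_wedge_eq_zero (norm_ne_zero_iff.1 (by simp [he]))
    fun x => sub_eq_zero.2 (ha x)
  refine ⟨b + a, fun x => ?_⟩
  have hx := LinearMap.congr_fun hDab x
  simp only [LinearMap.sub_apply, LieAlgebra.ad_apply, LinearMap.zero_apply] at hx
  rw [add_lie, ← sub_eq_iff_eq_add', ← sub_eq_zero, hx]

end

theorem mainTheorem3 {H : Type*} [NormedAddCommGroup H] [InnerProductSpace ℂ H] [CompleteSpace H]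
    [TopologicalSpace.SeparableSpace H]
    (D : skewAdjointOperators H →ₗ[ℝ] skewAdjointOperators H)
    (hD : IsLocalInnerDerivation D)
    (hcont : Continuous[skewUltraweakTopology H, skewUltraweakTopology H] D) :
    IsInnerDerivation D :=
  mainTheorem3_general hD
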